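/- Let $\mathbb K=\mathbb R$ or $\mathbb C$, let $\mathfrak s$ be a finite-dimensional semisimple Lie algebra over $\mathbb K$, and let $\mathfrak g=\mathfrak s\oplus\mathbb K$ be its one-dimensional trivial central extension, so that $\mathfrak g^*=\mathfrak s^*\oplus\mathbb K^*$. Let $\pi_1$ denote the canonical Lie--Poisson bivector (field) of $\mathfrak g^*$ and also that of $\mathfrak s^*$. For a function $f$ write $\pi_1(f)=[\pi_1,f]$ for the hamiltonian vector field given by the contraction of $\pi_1$ with $df$ over the second index, that is, $\pi_1(f)g=\{g,f\}_{\pi_1}$; here $[\,,]$ is the Schouten bracket. Let $\pi_2$ be a quadratic Poisson bivector on $\mathfrak g^*$ that is centrally linearizable at some nonzero $a\in\mathbb K^*\subset\mathfrak g^*$: the bivector $\pi_2$ vanishes at $a$, and its linearization $[T_a,\pi_2]$ at $a$ equals $\pi_1$, where $T_a$ is the constant vector field generating the translations $x\mapsto x+ta$. Let $x_0$ be the linear coordinate on $\mathfrak g^*$ with $x_0(a)=1$ and $x_0|_{\mathfrak s^*}=0$, so that $T_a=\partial/\partial x_0$, and let $E$ be the Euler vector field on $\mathfrak s^*$. Let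 $X$ be a quadratic vector field on $\mathfrak s^*$ and $q$ a quadratic homogeneous polynomial on $\mathfrak s^*$ corresponding to $\pi_2$, that is, such that (treating $X$, $q$, $E$ also as objects on $\mathfrak g^*$ independent of $x_0$) $$\pi_2=[\widetilde X,\pi_1]=\mathcal L_{\widetilde X}\pi_1,\qquad \widetilde X=X+q\,\frac{\partial}{\partial x_0}-x_0E .$$ Then there exists a cubic homogeneous polynomial $m$ on $\mathfrak s^*$ such that $$[X,\pi_1(q)]=\pi_1(m)$$ as vector fields on $\mathfrak s^*$. -/

import Mathlib

open MvPolynomial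

noncomputable section

/-- Polynomial vector fields on the affine space with linear coordinates `X i`, `i : σ`: the
derivations of the coordinate ring. The Lie bracket of vector fields is the commutator of
derivations, and the coefficient of `∂/∂x_i` in `Y` is `Y (X i)`. -/
abbrev PolyVectorField (σ R : Type*) [CommRing R] :=
  Derivation R (MvPolynomial σ R) (MvPolynomial σ R)

namespace PolyVectorField

variable {σ τ R : Type*} [CommRing R]

/-- All coefficients are homogeneous of degree `k` (`k = 2`: a quadratic vector field). -/
def IsHomogeneous (Y : PolyVectorField σ R) (k : ℕ) : Prop :=
  ∀ i, (Y (X i)).IsHomogeneous k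

/-- The Euler vector field `∑ x_i ∂/∂x_i`. -/
def euler (σ R : Type*) [CommRing R] : PolyVectorField σ R :=
  mkDerivation R fun i => X i

/-- The constant vector field `T_a` generating the translations `x ↦ x + t a`. -/
def translation (a : σ → R) : PolyVectorField σ R :=
  mkDerivation R fun i => C (a i)

/-- A vector field in the coordinates indexed by `σ`, treated as a vector field in the coordinates
indexed by `σ ⊕ τ` whose coefficients at the additional coordinates vanish. -/
def extend (τ : Type*) (Y : PolyVectorField σ R) : PolyVectorField (σ ⊕ τ) R :=
  mkDerivation R (Sum.elim (fun i => rename Sum.inl (Y (X i))) fun _ => 0)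

end PolyVectorField

/-- A polynomial bivector `½ ∑ P i j ∂/∂x_i ∧ ∂/∂x_j` on the affine space with linear coordinates
`X i`, `i : σ`, given by its skew-symmetric matrix of coefficients (so `P i j = {x_i, x_j}`). -/
@[ext]
structure PolyBivector (σ R : Type*) [CommRing R] where
  coeff : σ → σ → MvPolynomial σ R
  diag : ∀ i, coeff i i = 0
  skew : ∀ i j, coeff i j = -coeff j i

namespace PolyBivector

variable {σ R : Type*} [CommRing R] [Fintype σ]

/-- All coefficients are homogeneous of degree `k` (`k = 2`: a quadratic bivector). -/
def IsHomogeneous (P : PolyBivector σ R) (k : ℕ) : Prop :=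
  ∀ i j, (P.coeff i j).IsHomogeneous k

/-- The bivector vanishes at the point with coordinates `a`. -/
def VanishesAt (P : PolyBivector σ R) (a : σ → R) : Prop :=
  ∀ i j, eval a (P.coeff i j) = 0

/-- The bracket of functions `{f, g} = ∑ P i j ∂f/∂x_i ∂g/∂x_j`. -/
def bracket (P : PolyBivector σ R) (f g : MvPolynomial σ R) : MvPolynomial σ R :=
  ∑ i, ∑ j, P.coeff i j * pderiv i f * pderiv j g

/-- `P` is a Poisson bivector: its bracket satisfies the Jacobi identity, that is, the Schouten
bracket `[P, P]` vanishes. -/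
def IsPoisson (P : PolyBivector σ R) : Prop :=
  ∀ f g h, P.bracket (P.bracket f g) h + P.bracket (P.bracket g h) f
    + P.bracket (P.bracket h f) g = 0

/-- The vector field `P(f) = [P, f]`: the contraction of `P` with `df` over the second index,
`P(f) g = {g, f}`. -/
def hamiltonian (P : PolyBivector σ R) (f : MvPolynomial σ R) : PolyVectorField σ R :=
  mkDerivation R fun i => ∑ j, P.coeff i j * pderiv j f

theorem bracket_skew (P : PolyBivector σ R) (f g : MvPolynomial σ R) :
    P.bracket f g = -P.bracket g f := by
  unfold bracket
  rw [Finset.sum_comm, ← Finset.sum_neg_distrib]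
  refine Finset.sum_congr rfl fun i _ => ?_
  rw [← Finset.sum_neg_distrib]
  refine Finset.sum_congr rfl fun j _ => ?_
  rw [P.skew j i]
  ring

/-- The Lie derivative `L_Y P = [Y, P]` of a bivector along a vector field,
`(L_Y P)(f, g) = Y {f, g} - {Y f, g} - {f, Y g}`, through its coefficients. -/
def lieDeriv (Y : PolyVectorField σ R) (P : PolyBivector σ R) : PolyBivector σ R where
  coeff i j := Y (P.coeff i j) - P.bracket (Y (X i)) (X j) - P.bracket (X i) (Y (X j))
  diag i := by
    rw [P.diag, P.bracket_skew (X i)]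
    simp
  skew i j := by
    rw [P.skew i j, P.bracket_skew (Y (X i)), P.bracket_skew (X i), map_neg]
    ring

end PolyBivector

namespace LiePoisson

variable {ι R L V : Type*} [CommRing R] [AddCommMonoid V] [Module R V] [LieRing L]
  [LieAlgebra R L] [Fintype ι]

/-- A vector `v` of the space `V` with basis `B`, as a linear function on `V^*`, where the
`i`-th linear coordinate on `V^*` is `B i`. -/
def linearFun (B : Module.Basis ι R V) (v : V) : MvPolynomial ι R :=
  ∑ k, C (B.repr v k) * X k

/-- The coordinates of a point of the dual space `V^*`. -/
def coords (B : Module.Basis ι R V) (a : Module.Dual R V) : ι → R :=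
  fun i => a (B i)

/-- The canonical Lie-Poisson bivector on `L^*`, `{x_i, x_j} = [x_i, x_j]`. -/
def bivector (B : Module.Basis ι R L) : PolyBivector ι R where
  coeff i j := linearFun B ⁅B i, B j⁆
  diag i := by simp [linearFun]
  skew i j := by
    rw [← lie_skew, linearFun, linearFun, ← Finset.sum_neg_distrib]
    refine Finset.sum_congr rfl fun k _ => ?_
    rw [map_neg, Finsupp.neg_apply, map_neg, neg_mul]

end LiePoisson

namespace CentralExtension

attribute [local instance] LieRing.ofAssociativeRing

variable {ι 𝕜 s : Type*} [Field 𝕜] [LieRing s] [LieAlgebra 𝕜 s] [Fintype ι]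

/-- The basis of the trivial one-dimensional central extension `s × 𝕜` of `s` given by a basis
of `s` and the element `(0, 1)`. -/
def basis (b : Module.Basis ι 𝕜 s) : Module.Basis (ι ⊕ Unit) 𝕜 (s × 𝕜) :=
  b.prod (Module.Basis.singleton Unit 𝕜)

/-- The linear coordinate `x_0` on `(s × 𝕜)^*` that is `1` at `a` and `0` on `s^*`, for a nonzero
`a` in `𝕜^*`. -/
def centralCoord (b : Module.Basis ι 𝕜 s) (a : Module.Dual 𝕜 (s × 𝕜)) :
    MvPolynomial (ι ⊕ Unit) 𝕜 :=
  LiePoisson.linearFun (basis b) (0, (a (0, 1))⁻¹)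

/-- The canonical Lie-Poisson bivector on `(s × 𝕜)^*`. -/
def liePoisson (b : Module.Basis ι 𝕜 s) : PolyBivector (ι ⊕ Unit) 𝕜 :=
  LiePoisson.bivector (L := s × 𝕜) (basis b)

/-- The vector field `T_a = ∂/∂x_0`. -/
def centralField (b : Module.Basis ι 𝕜 s) (a : Module.Dual 𝕜 (s × 𝕜)) :
    PolyVectorField (ι ⊕ Unit) 𝕜 :=
  PolyVectorField.translation (LiePoisson.coords (basis b) a)

/-- `P` is a quadratic Poisson bivector on `(s × 𝕜)^*` that is centrally linearizable at the
point `a`: `a` is a nonzero element of the summand `𝕜^*`, the bivector vanishes at `a`, and its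
linearization `[T_a, P]` at `a` is the canonical Lie-Poisson bivector of `s × 𝕜`. -/
structure IsCentrallyLinearizableAt (b : Module.Basis ι 𝕜 s) (P : PolyBivector (ι ⊕ Unit) 𝕜)
    (a : Module.Dual 𝕜 (s × 𝕜)) : Prop where
  isHomogeneous : P.IsHomogeneous 2
  isPoisson : P.IsPoisson
  apply_left : ∀ v : s, a (v, 0) = 0
  ne_zero : a ≠ 0
  vanishesAt : P.VanishesAt (LiePoisson.coords (basis b) a)
  linearization : PolyBivector.lieDeriv (centralField b a) P = liePoisson b

/-- The vector field `X + q ∂/∂x_0 - x_0 E` on `(s × 𝕜)^*`, where `X`, `q` and the Euler vector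
field `E` live on `s^*`. -/
def assembledField (b : Module.Basis ι 𝕜 s) (a : Module.Dual 𝕜 (s × 𝕜))
    (Y : PolyVectorField ι 𝕜) (q : MvPolynomial ι 𝕜) : PolyVectorField (ι ⊕ Unit) 𝕜 :=
  PolyVectorField.extend Unit Y + (rename Sum.inl q : MvPolynomial (ι ⊕ Unit) 𝕜) • centralField b a
    - centralCoord b a • PolyVectorField.extend Unit (PolyVectorField.euler ι 𝕜)

end CentralExtension

end

/-! Evaluate the Jacobi identity of `π₂` on two coordinates of `s^*` and the central one, then set
the central coordinate to zero. There the `s^*`-part of `π₂` is `L_X π₁`, while bracketing with the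
central coordinate is, up to a nonzero scalar, the field `π₁(q)` (`restrictInl_lieDeriv`,
`lieDeriv_inl_inr`). So the identity says that `π₁(q)` preserves `L_X π₁`. Since `π₁(q)` also
preserves `π₁`, the commutator `[X, π₁(q)]` preserves `π₁` (`commutator_hamiltonian_bracket`).

A Poisson vector field with cubic coefficients, restricted to linear functions, is a 1-cocycle of
`s` with values in the cubic polynomials on `s^*`. Whitehead's first lemma makes it a coboundary,
and a primitive is the required hamiltonian (`exists_hamiltonian_eq`). Whitehead's lemma reduces to
irreducible modules, where a Casimir operator inverts the coboundary. -/

namespace LieModule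

/-! ### Whitehead's first lemma. -/

open LieAlgebra

variable {K L M : Type*} [Field K] [LieRing L] [LieAlgebra K L]
  [AddCommGroup M] [Module K M] [LieRingModule L M] [LieModule K L M]

/-- The ideals form a Boolean algebra, and the part of `I` complementary to `⁅I, I⁆` is an abelian
ideal, hence zero. -/
theorem _root_.LieIdeal.lie_self_eq_of_isKilling [IsKilling K L] [Module.Finite K L]
    (I : LieIdeal K L) : ⁅I, I⁆ = I := by
  refine le_antisymm (LieSubmodule.lie_le_left I I) ?_
  have hab : IsLieAbelian (I ⊓ ⁅I, I⁆ᶜ : LieIdeal K L) := by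
    rw [LieSubmodule.lie_abelian_iff_lie_self_eq_bot, eq_bot_iff]
    refine (le_inf (LieSubmodule.mono_lie inf_le_left inf_le_left)
      ((LieSubmodule.lie_le_left _ _).trans inf_le_right)).trans ?_
    rw [inf_compl_eq_bot]
  have h := IsKilling.ideal_eq_bot_of_isLieAbelian (I ⊓ ⁅I, I⁆ᶜ : LieIdeal K L)
  rwa [← disjoint_iff, disjoint_compl_right_iff] at h

/-- The vectors killed by an ideal form a Lie submodule. -/
def idealInvariants (M : Type*) [AddCommGroup M] [Module K M] [LieRingModule L M]
    [LieModule K L M] (I : LieIdeal K L) : LieSubmodule K L M where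
  carrier := {m | ∀ x ∈ I, ⁅x, m⁆ = 0}
  add_mem' ha hb x hx := by rw [lie_add, ha x hx, hb x hx, add_zero]
  zero_mem' x _ := lie_zero x
  smul_mem' c m hm x hx := by rw [lie_smul, hm x hx, smul_zero]
  lie_mem {y m} hm x hx := by
    rw [leibniz_lie, hm _ (lie_mem_left K L I x y hx), hm x hx, lie_zero, add_zero]

/-- Nilpotency supplies a nonzero vector killed by `I`. Such vectors form an `L`-submodule, which
irreducibility forces to be everything. -/
theorem lie_eq_zero_of_isIrreducible_of_isNilpotent [IsIrreducible K L M] (I : LieIdeal K L)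
    [Nontrivial M] [LieModule.IsNilpotent I M] {x : L} (hx : x ∈ I) (m : M) : ⁅x, m⁆ = 0 := by
  obtain ⟨⟨v, hv⟩, hv0⟩ :=
    @exists_ne _ (nontrivial_max_triv_of_isNilpotent K I M) (0 : maxTrivSubmodule K I M)
  have htop : idealInvariants M I = ⊤ := by
    refine (IsSimpleOrder.eq_bot_or_eq_top (idealInvariants M I)).resolve_left fun hbot => hv0 ?_
    have hmem : v ∈ idealInvariants M I := fun y hy => hv ⟨y, hy⟩
    rw [hbot, LieSubmodule.mem_bot] at hmem
    exact Subtype.ext hmem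
  exact (htop ▸ LieSubmodule.mem_top m : m ∈ idealInvariants M I) x hx

/-- The elements orthogonal to everything under the trace form. -/
noncomputable def traceFormRadical (K L M : Type*) [Field K] [LieRing L] [LieAlgebra K L]
    [AddCommGroup M] [Module K M] [LieRingModule L M] [LieModule K L M] : LieIdeal K L :=
  InvariantForm.orthogonal (traceForm K L M) (traceForm_lieInvariant K L M) ⊤

theorem mem_traceFormRadical {x : L} :
    x ∈ traceFormRadical K L M ↔ ∀ y, traceForm K L M x y = 0 := by
  simp [traceFormRadical, InvariantForm.mem_orthogonal, traceForm_comm K L M x]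

theorem lie_eq_zero_of_mem_traceFormRadical [CharZero K] [IsKilling K L] [Module.Finite K L]
    [Module.Finite K M] [IsIrreducible K L M] {x : L} (hx : x ∈ traceFormRadical K L M) (m : M) :
    ⁅x, m⁆ = 0 := by
  have : Nontrivial M := nontrivial_of_isIrreducible K L M
  set I := traceFormRadical K L M
  have h0 : traceForm K I M = 0 := by
    ext y z
    exact mem_traceFormRadical.1 y.2 z
  -- Vanishing of the trace form gives nilpotency only for the derived ideal of `I`, but `I` is
  -- perfect.
  have hn := isNilpotent_derivedSeries_of_traceForm_eq_zero h0
  have : LieModule.IsNilpotent I M := by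
    rw [isNilpotent_iff_forall' (R := K)] at hn ⊢
    intro y
    refine hn ⟨y, ?_⟩
    rw [LieIdeal.derivedSeries_eq_derivedSeriesOfIdeal_comap, LieIdeal.mem_comap,
      derivedSeriesOfIdeal_succ, derivedSeriesOfIdeal_zero, LieIdeal.lie_self_eq_of_isKilling]
    exact y.2
  exact lie_eq_zero_of_isIrreducible_of_isNilpotent I hx m

/-- The radical and its Killing complement span `L`, so an element of the complement orthogonal to
the complement is orthogonal to all of `L`, and lies in both. -/
theorem traceForm_killingCompl_radical_nondegenerate [IsKilling K L] [Module.Finite K L] :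
    (traceForm K (traceFormRadical K L M).killingCompl M).Nondegenerate := by
  refine (traceForm_isSymm K _ M).isRefl.nondegenerate_iff_separatingLeft.mpr fun x hx => ?_
  have hc := (traceFormRadical K L M).isCompl_killingCompl
  have hxr : (x : L) ∈ traceFormRadical K L M := by
    refine mem_traceFormRadical.2 fun y => ?_
    obtain ⟨r, hr, j, hj, rfl⟩ :=
      (LieSubmodule.mem_sup _ _ y).1 (hc.sup_eq_top ▸ LieSubmodule.mem_top y)
    rw [map_add, traceForm_comm, mem_traceFormRadical.1 hr, zero_add]
    exact hx ⟨j, hj⟩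
  have : (x : L) ∈ (⊥ : LieIdeal K L) := hc.inf_eq_bot ▸ ⟨hxr, x.2⟩
  exact Subtype.ext ((LieSubmodule.mem_bot _).1 this)

omit [LieAlgebra K L] [LieRingModule L M] [LieModule K L M] in
/-- Invariance of the Casimir tensor of a nondegenerate invariant symmetric form. -/
theorem sum_lie_dualBasis_add_eq_zero {V : Type*} [AddCommGroup V] [Module K V]
    [LieRingModule L V] {ι : Type*} [Fintype ι] [DecidableEq ι] {B : LinearMap.BilinForm K V}
    (hB : B.Nondegenerate) (hs : B.IsSymm) (hi : B.lieInvariant L) (e : Module.Basis ι K V)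
    (φ : V →ₗ[K] V →ₗ[K] M) (x : L) :
    ∑ i, (φ ⁅x, e i⁆ (B.dualBasis hB e i) + φ (e i) ⁅x, B.dualBasis hB e i⁆) = 0 := by
  set d := B.dualBasis hB e with hd
  have hd' : B.dualBasis hB d = e := LinearMap.BilinForm.dualBasis_dualBasis hB hs e
  have h1 (i : ι) : ⁅x, e i⁆ = ∑ j, B ⁅x, e i⁆ (d j) • e j := by
    conv_lhs => rw [← e.sum_repr ⁅x, e i⁆]
    refine Finset.sum_congr rfl fun j _ => ?_
    rw [← LinearMap.BilinForm.dualBasis_repr_apply hB d, hd']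
  have h2 (i : ι) : ⁅x, d i⁆ = ∑ j, B ⁅x, d i⁆ (e j) • d j := by
    conv_lhs => rw [← d.sum_repr ⁅x, d i⁆]
    refine Finset.sum_congr rfl fun j _ => ?_
    rw [hd, LinearMap.BilinForm.dualBasis_repr_apply hB e]
  -- By invariance, the matrices of `x` in the dual bases are negative transposes of each other.
  have h3 : ∑ i, φ (e i) ⁅x, d i⁆ = -∑ i, φ ⁅x, e i⁆ (d i) := by
    calc ∑ i, φ (e i) ⁅x, d i⁆ = ∑ i, ∑ j, B ⁅x, d i⁆ (e j) • φ (e i) (d j) := by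
          refine Finset.sum_congr rfl fun i _ => ?_
          conv_lhs => rw [h2 i, map_sum]
          simp only [map_smul]
      _ = ∑ j, ∑ i, B ⁅x, d i⁆ (e j) • φ (e i) (d j) := Finset.sum_comm
      _ = _ := by
          rw [← Finset.sum_neg_distrib]
          refine Finset.sum_congr rfl fun j _ => ?_
          conv_rhs => rw [h1 j, map_sum, LinearMap.sum_apply, ← Finset.sum_neg_distrib]
          refine Finset.sum_congr rfl fun i _ => ?_
          rw [hi x (d i), hs.eq, map_smul, LinearMap.smul_apply, neg_smul]
  rw [Finset.sum_add_distrib, h3, add_neg_cancel]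

variable (K) in
/-- A `1`-cocycle with values in `M`. -/
def IsOneCocycle (f : L →ₗ[K] M) : Prop := ∀ x y, f ⁅x, y⁆ = ⁅x, f y⁆ - ⁅y, f x⁆

/-- The Casimir operator `C` of the trace form on `J` commutes with `L` and has trace `dim J`. If `J
= 0`, the action is trivial; otherwise `C` is invertible by Schur's argument. -/
theorem IsOneCocycle.exists_of_isIrreducible [CharZero K] [IsKilling K L] [Module.Finite K L]
    [Module.Finite K M] [IsIrreducible K L M] {f : L →ₗ[K] M} (hf : IsOneCocycle K f) :
    ∃ m, ∀ x, f x = ⁅x, m⁆ := by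
  classical
  set J := (traceFormRadical K L M).killingCompl with hJ
  have hB : (traceForm K J M).Nondegenerate := traceForm_killingCompl_radical_nondegenerate
  have hs : (traceForm K J M).IsSymm := ⟨traceForm_comm K J M⟩
  have hi : (traceForm K J M).lieInvariant L := fun x y z => traceForm_lieInvariant K L M x y z
  let e := Module.finBasis K J
  let d := (traceForm K J M).dualBasis hB e
  let C : Module.End K M := ∑ i, toEnd K L M (e i) ∘ₗ toEnd K L M (d i)
  have hCm (m : M) : C m = ∑ i, ⁅(e i : L), ⁅(d i : L), m⁆⁆ := by simp [C]
  have hcomm (x : L) (m : M) : C ⁅x, m⁆ = ⁅x, C m⁆ := by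
    let φ : J →ₗ[K] J →ₗ[K] M :=
      LinearMap.mk₂ K (fun a b => ⁅(a : L), ⁅(b : L), m⁆⁆) (by simp) (by simp) (by simp) (by simp)
    have h := sum_lie_dualBasis_add_eq_zero hB hs hi e φ x
    rw [hCm, hCm, lie_sum, eq_comm, ← sub_eq_zero, ← Finset.sum_sub_distrib, ← h]
    refine Finset.sum_congr rfl fun i _ => ?_
    simp only [φ, LinearMap.mk₂_apply, LieSubmodule.coe_bracket]
    rw [leibniz_lie x (e i : L), leibniz_lie x (d i : L), lie_add]
    simp only [d]
    abel
  have htr : LinearMap.trace K M C = Module.finrank K J := by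
    have h1 (i) : LinearMap.trace K M (toEnd K L M (e i) ∘ₗ toEnd K L M (d i)) = 1 := by
      have := LinearMap.BilinForm.apply_dualBasis_right hB hs e i i
      rwa [if_pos rfl] at this
    simp [C, h1]
  by_cases hJ0 : Module.finrank K J = 0
  · have hJb : J = ⊥ := by
      rw [← LieSubmodule.toSubmodule_eq_bot]
      exact Submodule.finrank_eq_zero.1 hJ0
    have hR : traceFormRadical K L M = ⊤ := by
      have := (traceFormRadical K L M).isCompl_killingCompl.sup_eq_top
      rwa [← hJ, hJb, sup_bot_eq] at this
    have h0 (x : L) (m : M) : ⁅x, m⁆ = 0 :=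
      lie_eq_zero_of_mem_traceFormRadical (K := K) (hR ▸ LieSubmodule.mem_top x) m
    refine ⟨0, fun x => ?_⟩
    -- With trivial action a cocycle kills all brackets, and these span `L`.
    have hx : x ∈ ⁅(⊤ : LieIdeal K L), (⊤ : LieIdeal K L)⁆ := by
      rw [LieIdeal.lie_self_eq_of_isKilling]
      exact LieSubmodule.mem_top x
    rw [← LieSubmodule.mem_toSubmodule, LieSubmodule.lieIdeal_oper_eq_linear_span'] at hx
    have : Submodule.span K {m | ∃ x ∈ (⊤ : LieIdeal K L), ∃ n ∈ (⊤ : LieIdeal K L), ⁅x, n⁆ = m}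
        ≤ LinearMap.ker f := by
      rw [Submodule.span_le]
      rintro _ ⟨y, -, z, -, rfl⟩
      simp [hf y z, h0]
    rw [lie_zero]
    exact this hx
  · let N : LieSubmodule K L M :=
      { LinearMap.ker C with
        lie_mem := fun {x m} hm => by
          change C m = 0 at hm
          change C ⁅x, m⁆ = 0
          rw [hcomm, hm, lie_zero] }
    have hker : LinearMap.ker C = ⊥ := by
      rcases IsSimpleOrder.eq_bot_or_eq_top N with h | h
      · rw [← LieSubmodule.toSubmodule_eq_bot] at h
        exact h
      · have : C = 0 := by
          ext m
          exact (h ▸ LieSubmodule.mem_top m : m ∈ N)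
        rw [this, map_zero] at htr
        exact absurd (Nat.cast_eq_zero.1 htr.symm) hJ0
    -- If `f x = ⁅x, m⁆`, then `C m` must be this sum. Conversely, the cocycle identity and
    -- invariance of the Casimir tensor give `C (f x) = ⁅x, C m⁆`, and `C` is injective.
    obtain ⟨m, hm⟩ := LinearMap.injective_iff_surjective.1 (LinearMap.ker_eq_bot.1 hker)
      (∑ i, ⁅(e i : L), f (d i)⁆)
    refine ⟨m, fun x => LinearMap.ker_eq_bot.1 hker ?_⟩
    let φ : J →ₗ[K] J →ₗ[K] M :=
      LinearMap.mk₂ K (fun a b => ⁅(a : L), f b⁆) (by simp) (by simp) (by simp) (by simp)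
    have h := sum_lie_dualBasis_add_eq_zero hB hs hi e φ x
    rw [hcomm, hm, hCm, lie_sum, eq_comm, ← sub_eq_zero, ← Finset.sum_sub_distrib, ← h]
    refine Finset.sum_congr rfl fun i _ => ?_
    simp only [φ, LinearMap.mk₂_apply, LieSubmodule.coe_bracket]
    rw [leibniz_lie x (e i : L), hf x]
    simp only [d, lie_sub]
    abel

/-- **Whitehead's first lemma**. -/
theorem IsOneCocycle.exists_eq_lie [CharZero K] [IsKilling K L] [Module.Finite K L]
    [Module.Finite K M] {f : L →ₗ[K] M} (hf : IsOneCocycle K f) :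
    ∃ m, ∀ x, f x = ⁅x, m⁆ := by
  induction hn : Module.finrank K M using Nat.strong_induction_on generalizing M with
  | _ n ih =>
  subst hn
  by_cases hM : Nontrivial M
  · by_cases hirr : ∃ N : LieSubmodule K L M, N ≠ ⊥ ∧ N ≠ ⊤
    · obtain ⟨N, hb, ht⟩ := hirr
      have hqd : Module.finrank K (M ⧸ N) < Module.finrank K M :=
by
        have hpos : 0 < Module.finrank K N.toSubmodule := by
          rw [Nat.pos_iff_ne_zero, ne_eq, Submodule.finrank_eq_zero,
            LieSubmodule.toSubmodule_eq_bot]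
          exact hb
        have := N.toSubmodule.finrank_quotient_add_finrank
        change Module.finrank K (M ⧸ N.toSubmodule) < _
        lia
      have hNd : Module.finrank K N < Module.finrank K M :=
        Submodule.finrank_lt (s := N.toSubmodule) (by simpa using ht)
      obtain ⟨v, hv⟩ := ih _ hqd (M := M ⧸ N)
        (f := (LieSubmodule.Quotient.mk' N : M →ₗ[K] M ⧸ N) ∘ₗ f)
        (fun x y => by
          change LieSubmodule.Quotient.mk' N (f ⁅x, y⁆) = ⁅x, LieSubmodule.Quotient.mk' N (f y)⁆
            - ⁅y, LieSubmodule.Quotient.mk' N (f x)⁆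
          rw [hf, map_sub, LieModuleHom.map_lie, LieModuleHom.map_lie]) rfl
      obtain ⟨m, rfl⟩ := LieSubmodule.Quotient.surjective_mk' N v
      have hmem (x : L) : f x - ⁅x, m⁆ ∈ N := by
        rw [← LieSubmodule.Quotient.mk_eq_zero, map_sub, sub_eq_zero]
        simpa using hv x
      -- Subtracting the coboundary of a lift of the quotient primitive leaves a cocycle with values
      -- in `N`.
      let g : L →ₗ[K] N := LinearMap.codRestrict N.toSubmodule
        (f - (toModuleHom K L M ∘ₗ (TensorProduct.mk K L M).flip m)) (fun x => by simpa using hmem x)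
      have hg (x : L) : (g x : M) = f x - ⁅x, m⁆ := rfl
      obtain ⟨n, hn⟩ := ih _ hNd (M := N) (f := g) (fun x y => by
        ext
        simp only [hg, hf x y, LieSubmodule.coe_bracket, LieSubmodule.coe_sub, lie_sub, lie_lie]
        abel) rfl
      refine ⟨m + n, fun x => ?_⟩
      have := congrArg (Subtype.val) (hn x)
      rw [hg] at this
      rw [lie_add, ← LieSubmodule.coe_bracket, ← this]
      abel
    · push Not at hirr
      have : IsIrreducible K L M := IsIrreducible.mk hirr
      exact hf.exists_of_isIrreducible
  · rw [not_nontrivial_iff_subsingleton] at hM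
    exact ⟨0, fun x => Subsingleton.elim _ _⟩

end LieModule

/-! ### Derivations and brackets of polynomial bivectors. -/

noncomputable section

theorem MvPolynomial.derivation_eq_sum {σ R : Type*} [CommRing R] [Fintype σ]
    (Y : Derivation R (MvPolynomial σ R) (MvPolynomial σ R)) (f : MvPolynomial σ R) :
    Y f = ∑ i, Y (X i) * pderiv i f := by
  classical
  have hs (D : σ → Derivation R (MvPolynomial σ R) (MvPolynomial σ R)) (g : MvPolynomial σ R) :
      (∑ i, D i) g = ∑ i, D i g := by
    rw [← Derivation.coeFnAddMonoidHom_apply, map_sum, Finset.sum_apply]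
    rfl
  have h : Y = ∑ i, Y (X i) • pderiv i := by
    refine derivation_ext fun k => ?_
    simp only [hs, Derivation.smul_apply, pderiv_X, smul_eq_mul]
    simp [Pi.single_apply]
  conv_lhs => rw [h]
  simp only [hs, Derivation.smul_apply, smul_eq_mul]

theorem PolyVectorField.IsHomogeneous.apply {σ R : Type*} [CommRing R] [Fintype σ]
    {Y : PolyVectorField σ R} {k : ℕ} (hY : Y.IsHomogeneous k) {f : MvPolynomial σ R} {n : ℕ}
    (hf : f.IsHomogeneous n) : (Y f).IsHomogeneous (k + (n - 1)) := by
  rw [derivation_eq_sum]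
  exact IsHomogeneous.sum _ _ _ fun i _ => (hY i).mul hf.pderiv

namespace PolyBivector

variable {σ R : Type*} [CommRing R] [Fintype σ] (P : PolyBivector σ R)

theorem hamiltonian_apply (f g : MvPolynomial σ R) : P.hamiltonian f g = P.bracket g f := by
  rw [derivation_eq_sum]
  refine Finset.sum_congr rfl fun i _ => ?_
  rw [hamiltonian, mkDerivation_X, Finset.sum_mul]
  exact Finset.sum_congr rfl fun j _ => mul_right_comm _ _ _

theorem bracket_X_X (i j : σ) : P.bracket (X i) (X j) = P.coeff i j := by
  classical
  simp [bracket, pderiv_X, Pi.single_apply]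

theorem bracket_X_right (f : MvPolynomial σ R) (j : σ) :
    P.bracket f (X j) = ∑ i, P.coeff i j * pderiv i f := by
  classical
  simp [bracket, pderiv_X, Pi.single_apply]

/-- The derivation `{f, ·}`. -/
def ad (f : MvPolynomial σ R) : PolyVectorField σ R := -P.hamiltonian f

theorem ad_apply (f g : MvPolynomial σ R) : P.ad f g = P.bracket f g := by
  rw [ad, Derivation.neg_apply, hamiltonian_apply, ← bracket_skew]

theorem bracket_add_left (f g h : MvPolynomial σ R) :
    P.bracket (f + g) h = P.bracket f h + P.bracket g h := by
  simp only [← hamiltonian_apply, map_add]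

theorem bracket_sub_left (f g h : MvPolynomial σ R) :
    P.bracket (f - g) h = P.bracket f h - P.bracket g h := by
  simp only [← hamiltonian_apply, map_sub]

theorem bracket_neg_left (f h : MvPolynomial σ R) :
    P.bracket (-f) h = -P.bracket f h := by
  simp only [← hamiltonian_apply, map_neg]

theorem bracket_smul_left (c : R) (f h : MvPolynomial σ R) :
    P.bracket (c • f) h = c • P.bracket f h := by
  simp only [← hamiltonian_apply, Derivation.map_smul]

theorem bracket_add_right (f g h : MvPolynomial σ R) :
    P.bracket f (g + h) = P.bracket f g + P.bracket f h := by
  simp only [← ad_apply, map_add]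

theorem bracket_sub_right (f g h : MvPolynomial σ R) :
    P.bracket f (g - h) = P.bracket f g - P.bracket f h := by
  simp only [← ad_apply, map_sub]

theorem bracket_smul_right (c : R) (f h : MvPolynomial σ R) :
    P.bracket f (c • h) = c • P.bracket f h := by
  simp only [← ad_apply, Derivation.map_smul]

/-- Both sides are derivations in each argument, so the coordinate formula defining `lieDeriv`
propagates one argument at a time. -/
theorem lieDeriv_bracket (Y : PolyVectorField σ R) (f g : MvPolynomial σ R) :
    (lieDeriv Y P).bracket f g =
      Y (P.bracket f g) - P.bracket (Y f) g - P.bracket f (Y g) := by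
  have h1 (i : σ) : (lieDeriv Y P).ad (X i) = ⁅Y, P.ad (X i)⁆ - P.ad (Y (X i)) := by
    refine derivation_ext fun j => ?_
    rw [Derivation.sub_apply, Derivation.commutator_apply]
    simp only [ad_apply, bracket_X_X]
    simp only [lieDeriv]
    ring
  have h2 : (lieDeriv Y P).hamiltonian g = ⁅Y, P.hamiltonian g⁆ - P.hamiltonian (Y g) := by
    refine derivation_ext fun i => ?_
    rw [Derivation.sub_apply, Derivation.commutator_apply]
    simp only [hamiltonian_apply]
    rw [← ad_apply, h1, Derivation.sub_apply, Derivation.commutator_apply]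
    simp only [ad_apply]
    ring
  rw [← hamiltonian_apply, h2, Derivation.sub_apply, Derivation.commutator_apply]
  simp only [hamiltonian_apply]

theorem bracket_eq_zero_of_coeff (hP : ∀ i j, P.coeff i j = 0) (f g : MvPolynomial σ R) :
    P.bracket f g = 0 := by
  simp [bracket, hP]

/-- The Jacobi identity on coordinates implies the Leibniz form of the Jacobi identity. -/
theorem ad_bracket_of_coord
    (hP : ∀ i j k, P.bracket (P.coeff i j) (X k) =
      P.bracket (P.coeff i k) (X j) + P.bracket (X i) (P.coeff j k))
    (f g : MvPolynomial σ R) : P.ad (P.bracket f g) = ⁅P.ad f, P.ad g⁆ := by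
  refine derivation_ext fun k => ?_
  -- Jacobi on coordinates says that the hamiltonian field of each coordinate preserves `P`.
  have h0 (i j : σ) : (lieDeriv (P.hamiltonian (X k)) P).coeff i j = 0 := by
    simp only [lieDeriv, hamiltonian_apply, bracket_X_X, hP i j k]
    simp
  have h := P.lieDeriv_bracket (P.hamiltonian (X k)) f g
  rw [bracket_eq_zero_of_coeff _ h0] at h
  simp only [hamiltonian_apply] at h
  simp only [Derivation.commutator_apply, ad_apply]
  rw [P.bracket_skew g (P.bracket f (X k))]
  linear_combination -h

theorem bracket_jacobi (hP : ∀ f g, P.ad (P.bracket f g) = ⁅P.ad f, P.ad g⁆)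
    (f g h : MvPolynomial σ R) :
    P.bracket (P.bracket f g) h = P.bracket f (P.bracket g h) - P.bracket g (P.bracket f h) := by
  rw [← ad_apply, hP f g, Derivation.commutator_apply]
  simp only [ad_apply]

/-- If the Lie derivative of `L_Y P` along `P(q)` vanishes, then `[Y, P(q)]` preserves `P`. -/
theorem commutator_hamiltonian_bracket
    (hP : ∀ f g, P.ad (P.bracket f g) = ⁅P.ad f, P.ad g⁆) (Y : PolyVectorField σ R)
    (q : MvPolynomial σ R)
    (h : ∀ i j, P.bracket ((lieDeriv Y P).coeff i j) q =
      (lieDeriv Y P).bracket (P.bracket (X i) q) (X j)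
        + (lieDeriv Y P).bracket (X i) (P.bracket (X j) q)) (f g : MvPolynomial σ R) :
    ⁅Y, P.hamiltonian q⁆ (P.bracket f g) =
      P.bracket (⁅Y, P.hamiltonian q⁆ f) g + P.bracket f (⁅Y, P.hamiltonian q⁆ g) := by
  have hH (f g : MvPolynomial σ R) : P.bracket (P.bracket f g) q =
      P.bracket (P.bracket f q) g + P.bracket f (P.bracket g q) := by
    rw [P.bracket_jacobi hP, P.bracket_skew (P.bracket f q)]
    ring
  -- With `H = P(q)`, `L_[Y,H] P = L_Y L_H P - L_H L_Y P`. The first term vanishes by `hH`, the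
  -- second by `h`.
  have h0 (i j : σ) : (lieDeriv ⁅Y, P.hamiltonian q⁆ P).coeff i j = 0 := by
    have hij := h i j
    rw [lieDeriv_bracket, lieDeriv_bracket] at hij
    simp only [lieDeriv, bracket_sub_left, hH] at hij
    simp only [lieDeriv, Derivation.commutator_apply, hamiltonian_apply, bracket_sub_left,
      bracket_sub_right]
    have e := congrArg Y (hH (X i) (X j))
    simp only [bracket_X_X, map_add] at e hij
    linear_combination e - hij
  have h1 := P.lieDeriv_bracket ⁅Y, P.hamiltonian q⁆ f g
  rw [bracket_eq_zero_of_coeff _ h0] at h1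
  linear_combination -h1

end PolyBivector

/-! ### Lie-Poisson brackets and Poisson vector fields. -/

namespace LiePoisson

variable {ι R L : Type*} [CommRing R] [LieRing L] [LieAlgebra R L] [Fintype ι]

/-- `linearFun` as a linear map. -/
def linearFunₗ (b : Module.Basis ι R L) : L →ₗ[R] MvPolynomial ι R where
  toFun := linearFun b
  map_add' u v := by simp [linearFun, add_mul, Finset.sum_add_distrib]
  map_smul' c v := by simp [linearFun, Finset.smul_sum, smul_eq_C_mul, mul_assoc]

theorem linearFun_basis (b : Module.Basis ι R L) (i : ι) : linearFun b (b i) = X i := by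
  classical
  simp [linearFun, Finsupp.single_apply]

theorem bracket_linearFun (b : Module.Basis ι R L) (u v : L) :
    (bivector b).bracket (linearFun b u) (linearFun b v) = linearFun b ⁅u, v⁆ := by
  let lhs : L →ₗ[R] L →ₗ[R] MvPolynomial ι R :=
    LinearMap.mk₂ R (fun u v => (bivector b).bracket (linearFunₗ b u) (linearFunₗ b v))
      (by simp [PolyBivector.bracket_add_left]) (by simp [PolyBivector.bracket_smul_left])
      (by simp [PolyBivector.bracket_add_right]) (by simp [PolyBivector.bracket_smul_right])
  let rhs : L →ₗ[R] L →ₗ[R] MvPolynomial ι R :=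
    LinearMap.mk₂ R (fun u v => linearFunₗ b ⁅u, v⁆)
      (by simp) (by simp) (by simp) (by simp)
  have h : lhs = rhs := by
    refine b.ext fun i => b.ext fun j => ?_
    change (bivector b).bracket (linearFun b (b i)) (linearFun b (b j)) = linearFun b ⁅b i, b j⁆
    rw [linearFun_basis, linearFun_basis, PolyBivector.bracket_X_X, bivector]
  exact LinearMap.congr_fun₂ h u v

theorem coeff_bivector (b : Module.Basis ι R L) (i j : ι) :
    (bivector b).coeff i j = linearFun b ⁅b i, b j⁆ := rfl

theorem ad_bracket (b : Module.Basis ι R L) (f g : MvPolynomial ι R) :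
    (bivector b).ad ((bivector b).bracket f g) = ⁅(bivector b).ad f, (bivector b).ad g⁆ := by
  refine PolyBivector.ad_bracket_of_coord _ (fun i j k => ?_) f g
  simp only [coeff_bivector, ← linearFun_basis b, bracket_linearFun]
  rw [lie_lie, ← lie_skew ⁅b i, b k⁆ (b j), sub_eq_add_neg, add_comm]
  exact map_add (linearFunₗ b) _ _

theorem isHomogeneous_linearFun (b : Module.Basis ι R L) (v : L) :
    (linearFun b v).IsHomogeneous 1 :=
  IsHomogeneous.sum _ _ _ fun k _ => by simpa using (isHomogeneous_C ι _).mul (isHomogeneous_X R k)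

theorem isHomogeneous_bracket_linearFun (b : Module.Basis ι R L) (v : L) {n : ℕ}
    {p : MvPolynomial ι R} (hp : p.IsHomogeneous n) (hn : n ≠ 0) :
    ((bivector b).bracket (linearFun b v) p).IsHomogeneous n := by
  refine IsHomogeneous.sum _ _ _ fun i _ => IsHomogeneous.sum _ _ _ fun j _ => ?_
  have := ((isHomogeneous_linearFun b ⁅b i, b j⁆).mul
    ((isHomogeneous_linearFun b v).pderiv (i := i))).mul (hp.pderiv (i := j))
  rwa [show 1 + (1 - 1) + (n - 1) = n by lia] at this

/-- The action of a Lie algebra on the homogeneous polynomials of degree `n + 1` on its dual. -/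
@[reducible]
def homogeneousLieRingModule (b : Module.Basis ι R L) (n : ℕ) :
    LieRingModule L (homogeneousSubmodule ι R (n + 1)) where
  bracket v p := ⟨(bivector b).bracket (linearFun b v) p,
    isHomogeneous_bracket_linearFun b v p.2 n.succ_ne_zero⟩
  add_lie u v p := Subtype.ext <| by
    change (bivector b).bracket (linearFunₗ b (u + v)) p = _
    rw [map_add, PolyBivector.bracket_add_left]
    rfl
  lie_add v p p' := Subtype.ext <| PolyBivector.bracket_add_right _ _ _ _
  leibniz_lie u v p := Subtype.ext <| by
    change (bivector b).bracket _ ((bivector b).bracket _ _) =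
      (bivector b).bracket (linearFun b ⁅u, v⁆) p + (bivector b).bracket _ ((bivector b).bracket _ _)
    rw [← bracket_linearFun, PolyBivector.bracket_jacobi _ (ad_bracket b)]
    ring

theorem homogeneousLieModule (b : Module.Basis ι R L) (n : ℕ) :
    letI := homogeneousLieRingModule b n
    LieModule R L (homogeneousSubmodule ι R (n + 1)) :=
  letI := homogeneousLieRingModule b n
  { smul_lie := fun c v p => Subtype.ext <| by
      change (bivector b).bracket (linearFunₗ b (c • v)) p = _
      rw [map_smul, PolyBivector.bracket_smul_left]
      rfl
    lie_smul := fun c v p => Subtype.ext <| PolyBivector.bracket_smul_right _ _ _ _ }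

/-- On the dual of a semisimple Lie algebra every homogeneous Poisson vector field is hamiltonian. -/
theorem exists_hamiltonian_eq {K : Type*} [Field K] [CharZero K] [LieAlgebra K L]
    [LieAlgebra.IsKilling K L] (b : Module.Basis ι K L) (n : ℕ) {Z : PolyVectorField ι K}
    (hZ : Z.IsHomogeneous (n + 1))
    (hP : ∀ f g, Z ((bivector b).bracket f g) =
      (bivector b).bracket (Z f) g + (bivector b).bracket f (Z g)) :
    ∃ m : MvPolynomial ι K, m.IsHomogeneous (n + 1) ∧ Z = (bivector b).hamiltonian m := by
  let := homogeneousLieRingModule b n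
  have := homogeneousLieModule b n
  have : Module.Finite K L := .of_basis b
  have : Module.Finite K (homogeneousSubmodule ι K (n + 1)) :=
    Module.Finite.iff_fg.2 (homogeneousSubmodule_fg ι K (n + 1))
  let f : L →ₗ[K] homogeneousSubmodule ι K (n + 1) :=
    LinearMap.codRestrict _ ((Z : MvPolynomial ι K →ₗ[K] MvPolynomial ι K) ∘ₗ linearFunₗ b)
      fun v => hZ.apply (isHomogeneous_linearFun b v)
  -- On linear functions, preserving the bracket is exactly the cocycle identity.
  have hf : LieModule.IsOneCocycle K f := fun u v => Subtype.ext <| by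
    change Z (linearFun b ⁅u, v⁆) = (bivector b).bracket (linearFun b u) (Z (linearFun b v))
      - (bivector b).bracket (linearFun b v) (Z (linearFun b u))
    rw [← bracket_linearFun, hP, PolyBivector.bracket_skew _ (Z (linearFun b u))]
    ring
  obtain ⟨m, hm⟩ := hf.exists_eq_lie
  refine ⟨m, m.2, derivation_ext fun i => ?_⟩
  rw [PolyBivector.hamiltonian_apply, ← linearFun_basis b]
  exact congrArg Subtype.val (hm (b i))

end LiePoisson

/-- The restriction of polynomials to the subspace where the additional coordinate vanishes. -/
def MvPolynomial.restrictInl (ι R : Type*) [CommRing R] :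
    MvPolynomial (ι ⊕ Unit) R →ₐ[R] MvPolynomial ι R :=
  aeval (Sum.elim X fun _ => 0)

/-! ### Restriction to the hyperplane where the central coordinate vanishes. -/

section Restrict

variable {ι R : Type*} [CommRing R]

@[simp]
theorem MvPolynomial.restrictInl_X_inl (i : ι) : restrictInl ι R (X (Sum.inl i)) = X i := by
  simp [restrictInl]

@[simp]
theorem MvPolynomial.restrictInl_X_inr (u : Unit) : restrictInl ι R (X (Sum.inr u)) = 0 := by
  simp [restrictInl]

@[simp]
theorem MvPolynomial.restrictInl_C (c : R) : restrictInl ι R (C c) = C c := by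
  simp [restrictInl, algebraMap_eq]

@[simp]
theorem MvPolynomial.restrictInl_rename (f : MvPolynomial ι R) :
    restrictInl ι R (rename Sum.inl f) = f := by
  rw [restrictInl, aeval_rename, Sum.elim_comp_inl, aeval_X_left_apply]

theorem MvPolynomial.restrictInl_pderiv_inl (i : ι) (f : MvPolynomial (ι ⊕ Unit) R) :
    restrictInl ι R (pderiv (Sum.inl i) f) = pderiv i (restrictInl ι R f) := by
  classical
  induction f using MvPolynomial.induction_on with
  | C c => simp
  | add p q hp hq => simp [hp, hq]
  | mul_X p k hp =>
    rcases k with k | k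
    · simp only [Derivation.leibniz, map_add, map_mul, smul_eq_mul, hp, restrictInl_X_inl,
        pderiv_X, Pi.single_apply, Sum.inl.injEq]
      split_ifs <;> simp
    · simp [hp, pderiv_X]

theorem MvPolynomial.pderiv_inl_rename (i : ι) (f : MvPolynomial ι R) :
    pderiv (Sum.inl i) (rename Sum.inl f : MvPolynomial (ι ⊕ Unit) R) =
      rename Sum.inl (pderiv i f) :=
  pderiv_rename Sum.inl_injective i f

theorem MvPolynomial.pderiv_inr_rename (u : Unit) (f : MvPolynomial ι R) :
    pderiv (Sum.inr u) (rename Sum.inl f : MvPolynomial (ι ⊕ Unit) R) = 0 := by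
  classical
  refine pderiv_eq_zero_of_notMem_vars fun h => ?_
  have := vars_rename (Sum.inl : ι → ι ⊕ Unit) f h
  simp at this

variable [Fintype ι]

/-- Along the subspace, the bracket with a function of the first coordinates only depends on the
restricted bracket, up to the contribution of the additional coordinate. -/
theorem PolyBivector.restrictInl_bracket_rename {P : PolyBivector (ι ⊕ Unit) R}
    {Q : PolyBivector ι R}
    (h : ∀ i j, restrictInl ι R (P.coeff (Sum.inl i) (Sum.inl j)) = Q.coeff i j)
    (f g : MvPolynomial ι R) :
    restrictInl ι R (P.bracket (rename Sum.inl f) (rename Sum.inl g)) = Q.bracket f g := by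
  simp [bracket, Fintype.sum_sum_type, pderiv_inl_rename, pderiv_inr_rename, h]

theorem MvPolynomial.restrictInl_derivation_rename (Y : PolyVectorField (ι ⊕ Unit) R)
    {Z : PolyVectorField ι R} (h : ∀ i, restrictInl ι R (Y (X (Sum.inl i))) = Z (X i))
    (f : MvPolynomial ι R) : restrictInl ι R (Y (rename Sum.inl f)) = Z f := by
  rw [derivation_eq_sum Y, derivation_eq_sum Z]
  simp [Fintype.sum_sum_type, pderiv_inl_rename, pderiv_inr_rename, h]

end Restrict

theorem LiePoisson.linearFun_zero {ι R V : Type*} [CommRing R] [AddCommMonoid V] [Module R V]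
    [Fintype ι] (B : Module.Basis ι R V) : linearFun B 0 = 0 := by
  simp [linearFun]

/-! ### The Lie-Poisson structure of the central extension. -/

namespace CentralExtension

attribute [local instance] LieRing.ofAssociativeRing

variable {ι 𝕜 s : Type*} [Field 𝕜] [LieRing s] [LieAlgebra 𝕜 s] [Fintype ι]
  (b : Module.Basis ι 𝕜 s)

omit [Fintype ι] in
theorem basis_inl (i : ι) : basis b (Sum.inl i) = (b i, 0) := by
  simp [basis]

omit [Fintype ι] in
theorem basis_inr (u : Unit) : basis b (Sum.inr u) = (0, 1) := by
  simp [basis]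

theorem linearFun_basis_prod (v : s) (t : 𝕜) : LiePoisson.linearFun (basis b) (v, t) =
    rename Sum.inl (LiePoisson.linearFun b v) + C t * X (Sum.inr ()) := by
  simp [LiePoisson.linearFun, basis, Fintype.sum_sum_type]

theorem liePoisson_inl_inl (i j : ι) : (liePoisson b).coeff (Sum.inl i) (Sum.inl j) =
    rename Sum.inl ((LiePoisson.bivector b).coeff i j) := by
  change LiePoisson.linearFun (basis b) ⁅basis b (Sum.inl i), basis b (Sum.inl j)⁆ = _
  rw [basis_inl, basis_inl, show ⁅((b i, 0) : s × 𝕜), ((b j, 0) : s × 𝕜)⁆ = (⁅b i, b j⁆, 0) by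
    ext <;> simp, linearFun_basis_prod, C_0, zero_mul, add_zero]
  rfl

theorem liePoisson_inr (k : ι ⊕ Unit) (u : Unit) : (liePoisson b).coeff k (Sum.inr u) = 0 := by
  change LiePoisson.linearFun (basis b) ⁅basis b k, basis b (Sum.inr u)⁆ = _
  have h : ⁅basis b k, basis b (Sum.inr u)⁆ = 0 := by
    rw [basis_inr]
    ext
    · simp
    · exact (Commute.all _ _).lie_eq
  simp [h, LiePoisson.linearFun]

theorem liePoisson_inr_left (k : ι ⊕ Unit) (u : Unit) : (liePoisson b).coeff (Sum.inr u) k = 0 := by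
  rw [(liePoisson b).skew, liePoisson_inr, neg_zero]

theorem liePoisson_bracket_rename (f g : MvPolynomial ι 𝕜) :
    (liePoisson b).bracket (rename Sum.inl f) (rename Sum.inl g) =
      rename Sum.inl ((LiePoisson.bivector b).bracket f g) := by
  simp [PolyBivector.bracket, Fintype.sum_sum_type, pderiv_inl_rename, pderiv_inr_rename,
    liePoisson_inl_inl]

/-- The central coordinate is a Casimir function, so its derivatives never enter the bracket. -/
theorem restrictInl_liePoisson_bracket (f g : MvPolynomial (ι ⊕ Unit) 𝕜) :
    restrictInl ι 𝕜 ((liePoisson b).bracket f g) =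
      (LiePoisson.bivector b).bracket (restrictInl ι 𝕜 f) (restrictInl ι 𝕜 g) := by
  simp [PolyBivector.bracket, Fintype.sum_sum_type, restrictInl_pderiv_inl, liePoisson_inl_inl,
    liePoisson_inr, liePoisson_inr_left]

variable {b} {a : Module.Dual 𝕜 (s × 𝕜)} (ha : ∀ v : s, a (v, 0) = 0) (Y : PolyVectorField ι 𝕜)
  (q : MvPolynomial ι 𝕜)

include ha in
theorem restrictInl_assembledField (i : ι) :
    restrictInl ι 𝕜 (assembledField b a Y q (X (Sum.inl i))) = Y (X i) := by
  simp [assembledField, PolyVectorField.extend, centralField, PolyVectorField.translation,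
    centralCoord, LiePoisson.coords, basis_inl, ha, linearFun_basis_prod, LiePoisson.linearFun_zero]

theorem assembledField_inr :
    assembledField b a Y q (X (Sum.inr ())) = a (0, 1) • rename Sum.inl q := by
  simp [assembledField, PolyVectorField.extend, centralField, PolyVectorField.translation,
    LiePoisson.coords, basis_inr, smul_eq_C_mul, mul_comm]

-- On the hyperplane the term `x_0 E` vanishes, and `q ∂/∂x_0` does not act on functions of the
-- `s^*`-coordinates.
include ha in
theorem restrictInl_lieDeriv (i j : ι) :
    restrictInl ι 𝕜 ((PolyBivector.lieDeriv (assembledField b a Y q) (liePoisson b)).coeff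
      (Sum.inl i) (Sum.inl j)) =
      (PolyBivector.lieDeriv Y (LiePoisson.bivector b)).coeff i j := by
  simp only [PolyBivector.lieDeriv, map_sub, liePoisson_inl_inl, restrictInl_liePoisson_bracket,
    restrictInl_assembledField ha, restrictInl_X_inl,
    restrictInl_derivation_rename _ (restrictInl_assembledField ha Y q)]

/-- Only the derivative of the central coordinate along the assembled field contributes. The basis
coordinate is `a (0, 1)` times `x_0`, whence the factor. -/
theorem lieDeriv_inl_inr (i : ι) :
    (PolyBivector.lieDeriv (assembledField b a Y q) (liePoisson b)).coeff
      (Sum.inl i) (Sum.inr ()) =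
      -(a (0, 1) • rename Sum.inl ((LiePoisson.bivector b).bracket (X i) q)) := by
  have h : (X (Sum.inl i) : MvPolynomial (ι ⊕ Unit) 𝕜) = rename Sum.inl (X i) := by simp
  simp only [PolyBivector.lieDeriv, liePoisson_inr, PolyBivector.bracket_X_right,
    assembledField_inr, PolyBivector.bracket_smul_right]
  rw [h, liePoisson_bracket_rename]
  simp

end CentralExtension

end

/-! ### The Jacobi identity of `π₂` on the hyperplane. -/

theorem mainTheorem8 {𝕜 : Type*} [RCLike 𝕜] {s : Type*} [LieRing s] [LieAlgebra 𝕜 s]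
    [LieAlgebra.IsSemisimple 𝕜 s] {ι : Type*} [Fintype ι] (b : Module.Basis ι 𝕜 s)
    (π₂ : PolyBivector (ι ⊕ Unit) 𝕜) (a : Module.Dual 𝕜 (s × 𝕜))
    (hCL : CentralExtension.IsCentrallyLinearizableAt b π₂ a)
    (X : PolyVectorField ι 𝕜) (hX : X.IsHomogeneous 2)
    (q : MvPolynomial ι 𝕜) (hq : q.IsHomogeneous 2)
    (hπ₂ : π₂ = PolyBivector.lieDeriv (CentralExtension.assembledField b a X q)
      (CentralExtension.liePoisson b)) :
    ∃ m : MvPolynomial ι 𝕜, m.IsHomogeneous 3 ∧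
      ⁅X, (LiePoisson.bivector b).hamiltonian q⁆ = (LiePoisson.bivector b).hamiltonian m := by
  have : Module.Finite 𝕜 s := .of_basis b
  have hH : ((LiePoisson.bivector b).hamiltonian q).IsHomogeneous 2 := fun i => by
    rw [PolyBivector.hamiltonian_apply, ← LiePoisson.linearFun_basis b]
    exact LiePoisson.isHomogeneous_bracket_linearFun b _ hq two_ne_zero
  refine LiePoisson.exists_hamiltonian_eq b 2 (fun i => ?_)
    (PolyBivector.commutator_hamiltonian_bracket _ (LiePoisson.ad_bracket b) X q fun i j => ?_)
  · rw [Derivation.commutator_apply]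
    exact (hX.apply (hH i)).sub (hH.apply (hX i))
  have hc : a (0, 1) ≠ 0 := fun h0 => hCL.ne_zero <| LinearMap.ext fun ⟨v, t⟩ => by
    have : ((v, t) : s × 𝕜) = (v, 0) + t • (0, 1) := by simp
    rw [this, map_add, map_smul, hCL.apply_left, h0, smul_zero, add_zero, LinearMap.zero_apply]
  have hQ := CentralExtension.restrictInl_lieDeriv (b := b) hCL.apply_left X q
  have hR (i : ι) := CentralExtension.lieDeriv_inl_inr (b := b) (a := a) X q i
  rw [← hπ₂] at hQ hR
  have hx (i : ι) : (MvPolynomial.X (Sum.inl i) : MvPolynomial (ι ⊕ Unit) 𝕜)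
      = rename Sum.inl (MvPolynomial.X i) := by simp
  -- The central coordinate has zero bracket with itself, so bracketing with it differentiates only
  -- along `s^*` and commutes with restriction.
  have hy (f : MvPolynomial (ι ⊕ Unit) 𝕜) :
      restrictInl ι 𝕜 (π₂.bracket f (MvPolynomial.X (Sum.inr ()))) =
        -(a (0, 1) • (LiePoisson.bivector b).bracket (restrictInl ι 𝕜 f) q) := by
    rw [PolyBivector.bracket_X_right, Fintype.sum_sum_type, ← PolyBivector.hamiltonian_apply,
      derivation_eq_sum]
    simp [hR, π₂.diag, restrictInl_pderiv_inl, PolyBivector.hamiltonian_apply, Finset.smul_sum]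
  have hJ := congrArg (restrictInl ι 𝕜) (hCL.isPoisson (MvPolynomial.X (Sum.inl i))
    (MvPolynomial.X (Sum.inl j)) (MvPolynomial.X (Sum.inr ())))
  rw [π₂.bracket_skew (MvPolynomial.X (Sum.inr ()))] at hJ
  simp only [PolyBivector.bracket_X_X, map_add, hy, hR, map_zero, hQ] at hJ
  simp only [hx, ← map_neg, ← map_smul, PolyBivector.restrictInl_bracket_rename hQ] at hJ
  simp only [neg_neg, PolyBivector.bracket_neg_left, PolyBivector.bracket_smul_left] at hJ
  -- Every term carries the factor `a (0, 1)`, which is cancelled.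
  rw [← smul_neg, ← smul_neg, ← smul_add, ← smul_add, smul_eq_zero, or_iff_right hc] at hJ
  rw [(PolyBivector.lieDeriv X _).bracket_skew (MvPolynomial.X i)]
  linear_combination -hJ
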